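/- A quantaloid is a category whose hom-sets are complete lattices such that composition preserves arbitrary suprema in each variable. $\mathsf{Sup}$ is the quantaloid of complete lattices and maps preserving arbitrary suprema, ordered pointwise. Let $\mathcal{Q}$ be a small quantaloid. A (right) $\mathcal{Q}$-module is a functor $\mathcal{Q}^{\mathsf{op}}\to\mathsf{Sup}$ that preserves arbitrary suprema of arrows, and $\mathsf{QUANT}(\mathcal{Q}^{\mathsf{op}},\mathsf{Sup})$ is the quantaloid of $\mathcal{Q}$-modules and natural transformations, ordered componentwise. A module is representable if it is isomorphic to $\mathcal{Q}(-,X)$ for some object $X$ of $\mathcal{Q}$. A direct sum of a (set-indexed, possibly empty) family $(\mathcal{M}_i)_{i\in I}$ in a quantaloid is an object $\mathcal{S}$ with arrows $s_i\colon\mathcal{M}_i\to\mathcal{S}$ and $p_i\colon\mathcal{S}\to\mathcal{M}_i$ such that $p_i s_i=1$, $p_j s_i=\bot$ for $i\neq j$, and $\bigvee_i s_i p_i=1_{\mathcal{S}}$. An object $\mathcal{F}$ is projective if every arrow $\mathcal{F}\to\mathcal{B}$ factors through every epimorphism $\mathcal{C}\to\mathcal{B}$; and $\mathcal{F}$ is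 a retract of $\mathcal{S}$ if there are arrows $\mathcal{F}\to\mathcal{S}\to\mathcal{F}$ whose composite is $1_{\mathcal{F}}$. **Proposition.** For every small quantaloid $\mathcal{Q}$, an object $\mathcal{F}$ of $\mathsf{QUANT}(\mathcal{Q}^{\mathsf{op}},\mathsf{Sup})$ is projective if and only if it is a retract of a direct sum of a (set-indexed) family of representable $\mathcal{Q}$-modules. -/

import Mathlib

open CategoryTheory

universe w v u v₁ u₁

/-- The complete lattice structure that is reflected along an injection `φ` into a complete
lattice: `a ≤ b` means `φ a ≤ φ b`, and suprema are computed by `s`. -/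
abbrev completeLatticeOfInjective {α : Type u} {β : Type v} [CompleteLattice β] (φ : α → β)
    (hφ : Function.Injective φ) (s : Set α → α) (hs : ∀ S, φ (s S) = sSup (φ '' S)) :
    CompleteLattice α :=
  letI : PartialOrder α := PartialOrder.lift φ hφ
  letI : SupSet α := ⟨s⟩
  completeLatticeOfSup α fun S => by
    constructor
    · intro a ha
      change φ a ≤ φ (s S)
      rw [hs]
      exact le_sSup ⟨a, ha, rfl⟩
    · intro b hb
      change φ (s S) ≤ φ b
      rw [hs]
      refine sSup_le ?_
      rintro _ ⟨a, ha, rfl⟩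
      exact hb ha

/-- A quantaloid: a category whose hom-sets are complete lattices such that composition
preserves arbitrary suprema in each variable. -/
class Quantaloid (C : Type u) [Category.{v} C] where
  homLattice : ∀ X Y : C, CompleteLattice (X ⟶ Y)
  comp_sSup : ∀ {X Y Z : C} (f : X ⟶ Y) (S : Set (Y ⟶ Z)),
    f ≫ sSup S = sSup ((fun g => f ≫ g) '' S)
  sSup_comp : ∀ {X Y Z : C} (S : Set (X ⟶ Y)) (g : Y ⟶ Z),
    sSup S ≫ g = sSup ((fun f => f ≫ g) '' S)

attribute [reducible, instance] Quantaloid.homLattice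

namespace Quantaloid

/-- The opposite of a quantaloid, with the same order on the (reversed) arrows. -/
instance opposite (C : Type u) [Category.{v} C] [Quantaloid C] : Quantaloid Cᵒᵖ where
  homLattice X Y :=
    completeLatticeOfInjective (fun f : X ⟶ Y => f.unop) Quiver.Hom.unop_inj
      (fun S => (sSup ((fun f : X ⟶ Y => f.unop) '' S)).op) (fun _ => rfl)
  comp_sSup {X Y Z} f S := by
    apply Quiver.Hom.unop_inj
    change sSup ((fun f : Y ⟶ Z => f.unop) '' S) ≫ f.unop =
      sSup ((fun f : X ⟶ Z => f.unop) '' _)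
    rw [sSup_comp, Set.image_image, Set.image_image]
    rfl
  sSup_comp {X Y Z} S g := by
    apply Quiver.Hom.unop_inj
    change g.unop ≫ sSup ((fun f : X ⟶ Y => f.unop) '' S) =
      sSup ((fun f : X ⟶ Z => f.unop) '' _)
    rw [comp_sSup, Set.image_image, Set.image_image]
    rfl

/-- For a quantaloid `D`, functors into `D` and natural transformations form a quantaloid,
with the componentwise order. -/
instance functorCategory (C : Type u) [Category.{v} C] (D : Type u₁) [Category.{v₁} D]
    [Quantaloid D] : Quantaloid (C ⥤ D) where
  homLattice F G :=
    completeLatticeOfInjective (fun (α : F ⟶ G) (X : C) => α.app X)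
      (fun _ _ h => NatTrans.ext h)
      (fun S =>
        { app := fun X => sSup ((fun α : F ⟶ G => α.app X) '' S)
          naturality := fun X Y f => by
            rw [comp_sSup, sSup_comp, Set.image_image, Set.image_image]
            congr 1
            exact Set.image_congr fun α _ => α.naturality f })
      (fun S => by
        funext X
        rw [sSup_apply_eq_sSup_image, Set.image_image])
  comp_sSup {F G H} f S := by
    ext X
    change f.app X ≫ sSup ((fun α : G ⟶ H => α.app X) '' S) =
      sSup ((fun α : F ⟶ H => α.app X) '' _)
    rw [comp_sSup, Set.image_image, Set.image_image]
    rfl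
  sSup_comp {F G H} S g := by
    ext X
    change sSup ((fun α : F ⟶ G => α.app X) '' S) ≫ g.app X =
      sSup ((fun α : F ⟶ H => α.app X) '' _)
    rw [sSup_comp, Set.image_image, Set.image_image]
    rfl

/-- A full subcategory of a quantaloid is a quantaloid, with the same order on arrows. -/
instance fullSubcategory (C : Type u) [Category.{v} C] [Quantaloid C] (P : ObjectProperty C) :
    Quantaloid P.FullSubcategory where
  homLattice X Y :=
    completeLatticeOfInjective (fun f : X ⟶ Y => f.hom) (fun _ _ h => ObjectProperty.hom_ext P h)
      (fun S => ObjectProperty.homMk (sSup ((fun f : X ⟶ Y => f.hom) '' S))) (fun _ => rfl)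
  comp_sSup {X Y Z} f S := by
    apply ObjectProperty.hom_ext
    change f.hom ≫ sSup ((fun g : Y ⟶ Z => g.hom) '' S) = sSup ((fun g : X ⟶ Z => g.hom) '' _)
    rw [comp_sSup, Set.image_image, Set.image_image]
    rfl
  sSup_comp {X Y Z} S g := by
    apply ObjectProperty.hom_ext
    change sSup ((fun g : X ⟶ Y => g.hom) '' S) ≫ g.hom = sSup ((fun g : X ⟶ Z => g.hom) '' _)
    rw [sSup_comp, Set.image_image, Set.image_image]
    rfl

/-- A functor between quantaloids is a homomorphism if it preserves arbitrary suprema of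
arrows. -/
def IsHomomorphism (C : Type u) [Category.{v} C] [Quantaloid C] (D : Type u₁) [Category.{v₁} D]
    [Quantaloid D] : ObjectProperty (C ⥤ D) := fun F =>
  ∀ (X Y : C) (S : Set (X ⟶ Y)), F.map (sSup S) = sSup ((fun f : X ⟶ Y => F.map f) '' S)

/-- `QUANT C D`: homomorphisms of quantaloids from `C` to `D`, with natural transformations as
arrows. -/
abbrev QUANT (C : Type u) [Category.{v} C] [Quantaloid C] (D : Type u₁) [Category.{v₁} D]
    [Quantaloid D] :=
  (IsHomomorphism C D).FullSubcategory

/-- The data exhibiting an object `S` of a quantaloid as the direct sum of a family `F`: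
injections and projections, orthogonal to each other, such that the supremum of the
idempotents `π i ≫ ι i` is the identity of `S`. -/
structure DirectSum {C : Type u} [Category.{v} C] [Quantaloid C] {I : Type w} (F : I → C)
    (S : C) where
  ι : ∀ i, F i ⟶ S
  π : ∀ i, S ⟶ F i
  ι_π_self : ∀ i, ι i ≫ π i = 𝟙 (F i)
  ι_π_ne : ∀ i j, i ≠ j → ι i ≫ π j = ⊥
  iSup_π_ι : ⨆ i, π i ≫ ι i = 𝟙 S

end Quantaloid

/-- A suplattice, that is, a complete lattice. -/
structure SupLat where
  of ::
  (carrier : Type u)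
  [str : CompleteLattice carrier]

attribute [instance] SupLat.str

namespace SupLat

instance : CoeSort SupLat.{u} (Type u) := ⟨SupLat.carrier⟩

/-- The category `Sup` of suplattices and supmorphisms (maps that preserve all suprema). -/
instance category : LargeCategory.{u} SupLat.{u} where
  Hom A B := sSupHom A B
  id A := sSupHom.id A
  comp f g := sSupHom.comp g f

instance : ConcreteCategory SupLat.{u} (fun A B => sSupHom A B) where
  hom f := f
  ofHom f := f

/-- The complete lattice of supmorphisms between two complete lattices, ordered pointwise. -/
abbrev supmorphismLattice (A B : Type u) [CompleteLattice A] [CompleteLattice B] :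
    CompleteLattice (sSupHom A B) :=
  completeLatticeOfInjective (fun (f : sSupHom A B) (a : A) => f a) DFunLike.coe_injective
    (fun S =>
      { toFun := fun a => ⨆ f ∈ S, f a
        map_sSup' := fun T => by
          simp only [map_sSup, sSup_image]
          rw [iSup₂_comm] })
    (fun S => by
      funext a
      rw [sSup_apply_eq_sSup_image, Set.image_image, sSup_image]
      rfl)

/-- The quantaloid structure of `Sup`: supmorphisms are ordered pointwise. -/
instance quantaloid : Quantaloid SupLat.{u} where
  homLattice A B := supmorphismLattice A B
  comp_sSup {A B C} f S := by
    apply sSupHom.ext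
    intro a
    change ⨆ g ∈ S, (g : sSupHom B C) ((f : sSupHom A B) a) =
      ⨆ h ∈ (fun g : B ⟶ C => f ≫ g) '' S, (h : sSupHom A C) a
    rw [iSup_image]
    rfl
  sSup_comp {A B C} S g := by
    apply sSupHom.ext
    intro a
    change (g : sSupHom B C) (⨆ f ∈ S, (f : sSupHom A B) a) =
      ⨆ h ∈ (fun f : A ⟶ B => f ≫ g) '' S, (h : sSupHom A C) a
    rw [iSup_image, map_iSup₂]
    rfl

end SupLat

namespace Quantaloid

/-- The quantaloid of (right) modules over a small quantaloid `Q`. -/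
abbrev QModule (Q : Type u) [SmallCategory Q] [Quantaloid Q] :=
  QUANT Qᵒᵖ SupLat.{u}

/-- The module `Q(-, X)`: it sends `Y` to the suplattice of arrows `Y ⟶ X`, and an arrow of `Q`
to precomposition with it. -/
def representableModule {Q : Type u} [SmallCategory Q] [Quantaloid Q] (X : Q) : QModule Q where
  obj :=
    { obj := fun Y => SupLat.of (Y.unop ⟶ X)
      map := fun {Y Z} f =>
        (⟨fun g => f.unop ≫ g, fun S => comp_sSup f.unop S⟩ :
          sSupHom (Y.unop ⟶ X) (Z.unop ⟶ X))
      map_id := fun Y => sSupHom.ext fun g => Category.id_comp g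
      map_comp := fun f g => sSupHom.ext fun h => Category.assoc g.unop f.unop h }
  property := fun Y Z S => by
    apply sSupHom.ext
    intro g
    change sSup ((fun f : Y ⟶ Z => f.unop) '' S) ≫ g = ⨆ h ∈ _, (h : sSupHom _ _) g
    rw [sSup_comp, Set.image_image, iSup_image, sSup_image]
    rfl

/-- A module is representable if it is isomorphic to some `Q(-, X)`. -/
def IsRepresentable {Q : Type u} [SmallCategory Q] [Quantaloid Q] (M : QModule Q) : Prop :=
  ∃ X : Q, Nonempty (M ≅ representableModule X)

end Quantaloid

/-! Representables are projective by Yoneda, once epimorphisms are known to be surjective in each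
component: a morphism out of `Q(-, X)` is an element at `X`, and elements lift along surjections
(`projective_representableModule`). Direct sums and retracts preserve projectivity. Conversely,
every module is covered by the direct sum of one representable for each of its elements, and
projectivity splits this cover.

The substantial point is `surjective_of_epi`. The two-element lattice 2 yields modules of
characters, and each element `b` of `B` gives a morphism from `B` to such a module recording which
translates of an element fail to lie below `b`. An epimorphism cannot identify two different
morphisms of this kind, which forces `b` into its image. -/

namespace Quantaloid

open Opposite

namespace QModule

/-! ### Elementwise calculus of modules -/

variable {Q : Type u} [SmallCategory Q] [Quantaloid Q]

/-- The suplattice of elements of a module at an object. -/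
abbrev elements (M : QModule Q) (X : Q) : Type u := M.obj.obj (op X)

/-- The action of an arrow of `Q` on a module. -/
def act (M : QModule Q) {Y X : Q} (f : Y ⟶ X) : sSupHom (M.elements X) (M.elements Y) :=
  M.obj.map f.op

/-- The component of a module morphism at an object. -/
def app {M N : QModule Q} (α : M ⟶ N) (X : Q) : sSupHom (M.elements X) (N.elements X) :=
  α.hom.app (op X)

lemma act_id (M : QModule Q) (X : Q) (m : M.elements X) : M.act (𝟙 X) m = m :=
  DFunLike.congr_fun (F := sSupHom _ _) (M.obj.map_id (op X)) m

lemma act_comp (M : QModule Q) {Z Y X : Q} (g : Z ⟶ Y) (f : Y ⟶ X) (m : M.elements X) :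
    M.act (g ≫ f) m = M.act g (M.act f m) :=
  DFunLike.congr_fun (F := sSupHom _ _) (M.obj.map_comp f.op g.op) m

lemma act_sSup (M : QModule Q) {Y X : Q} (S : Set (Y ⟶ X)) (m : M.elements X) :
    M.act (sSup S) m = ⨆ f ∈ S, M.act f m := by
  have h : (M.obj.map (sSup S).op : sSupHom _ _) m =
      ⨆ g ∈ (fun f : op X ⟶ op Y => M.obj.map f) '' (Quiver.Hom.unop ⁻¹' S),
        (g : sSupHom (M.elements X) (M.elements Y)) m := by
    have h₁ := DFunLike.congr_fun (F := sSupHom _ _)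
      (M.property (op X) (op Y) (Quiver.Hom.unop ⁻¹' S)) m
    have h₂ : (sSup (Quiver.Hom.unop ⁻¹' S) : op X ⟶ op Y) = (sSup S).op := by
      change (sSup ((fun f : op X ⟶ op Y => f.unop) '' (Quiver.Hom.unop ⁻¹' S))).op = _
      rw [Set.image_preimage_eq S (fun g => ⟨g.op, rfl⟩)]
    rw [h₂] at h₁
    exact h₁
  refine h.trans ?_
  rw [iSup_image]
  exact le_antisymm (iSup₂_le fun f hf => le_iSup₂_of_le f.unop hf le_rfl)
    (iSup₂_le fun f hf => le_iSup₂_of_le f.op hf le_rfl)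

lemma app_act {M N : QModule Q} (α : M ⟶ N) {Y X : Q} (f : Y ⟶ X) (m : M.elements X) :
    app α Y (M.act f m) = N.act f (app α X m) :=
  DFunLike.congr_fun (F := sSupHom _ _) (α.hom.naturality f.op) m

lemma app_comp {M N P : QModule Q} (α : M ⟶ N) (β : N ⟶ P) (X : Q) (m : M.elements X) :
    app (α ≫ β) X m = app β X (app α X m) := rfl

lemma app_sSup {M N : QModule Q} (S : Set (M ⟶ N)) (X : Q) (m : M.elements X) :
    app (sSup S) X m = ⨆ α ∈ S, app α X m := by
  change ⨆ g ∈ (fun β : M.obj ⟶ N.obj => β.app (op X)) '' ((fun α : M ⟶ N => α.hom) '' S),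
    (g : sSupHom (M.elements X) (N.elements X)) m = _
  rw [iSup_image, iSup_image]
  rfl

lemma app_bot {M N : QModule Q} (X : Q) (m : M.elements X) :
    app (⊥ : M ⟶ N) X m = ⊥ := by
  rw [← sSup_empty, app_sSup]
  simp

lemma app_iSup {M N : QModule Q} {I : Type w} (α : I → (M ⟶ N)) (X : Q) (m : M.elements X) :
    app (⨆ i, α i) X m = ⨆ i, app (α i) X m := by
  rw [iSup, app_sSup, iSup_range]

lemma hom_ext {M N : QModule Q} {α β : M ⟶ N} (h : ∀ X m, app α X m = app β X m) : α = β := by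
  apply ObjectProperty.hom_ext
  ext X : 2
  exact sSupHom.ext (h X.unop)

/-- Build a module from its suplattices of elements and its action. -/
def mk (E : Q → Type u) [∀ X, CompleteLattice (E X)]
    (a : ∀ {Y X : Q}, (Y ⟶ X) → sSupHom (E X) (E Y))
    (a_id : ∀ X (m : E X), a (𝟙 X) m = m)
    (a_comp : ∀ {Z Y X : Q} (g : Z ⟶ Y) (f : Y ⟶ X) (m : E X), a (g ≫ f) m = a g (a f m))
    (a_sSup : ∀ {Y X : Q} (S : Set (Y ⟶ X)) (m : E X), a (sSup S) m = ⨆ f ∈ S, a f m) :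
    QModule Q where
  obj :=
    { obj := fun X => SupLat.of (E X.unop)
      map := fun f => a f.unop
      map_id := fun X => sSupHom.ext (a_id X.unop)
      map_comp := fun f g => sSupHom.ext (a_comp g.unop f.unop) }
  property := fun X Y S => by
    apply sSupHom.ext
    intro m
    change a (sSup ((fun f : X ⟶ Y => f.unop) '' S)) m =
      ⨆ h ∈ (fun f : X ⟶ Y => a f.unop) '' S, (h : sSupHom (E X.unop) (E Y.unop)) m
    rw [a_sSup, iSup_image, iSup_image]

/-- Build a module morphism from its components. -/
def homMk {M N : QModule Q} (a : ∀ X, sSupHom (M.elements X) (N.elements X))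
    (a_act : ∀ {Y X : Q} (f : Y ⟶ X) (m : M.elements X), a Y (M.act f m) = N.act f (a X m)) :
    M ⟶ N :=
  ObjectProperty.homMk
    { app := fun X => a X.unop
      naturality := fun _ _ f => sSupHom.ext (a_act f.unop) }

/-! ### Epimorphisms are surjective -/

attribute [local instance] SupLat.supmorphismLattice

lemma sSupHom_sSup_apply {A B : Type u} [CompleteLattice A] [CompleteLattice B]
    (S : Set (sSupHom A B)) (a : A) : (sSup S) a = ⨆ f ∈ S, f a := rfl

/-- The module `Y ↦ Sup(Q(X, Y), 2)`, where `2` is the powerset of a point. -/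
def characters (X : Q) : QModule Q :=
  mk (fun Y => sSupHom (X ⟶ Y) (Set PUnit.{u + 1}))
    (fun {Z Y} f =>
      { toFun := fun φ =>
          { toFun := fun h => φ (h ≫ f)
            map_sSup' := fun S => by rw [sSup_comp, map_sSup, Set.image_image] }
        map_sSup' := fun S => sSupHom.ext fun h => by
          change (sSup S) (h ≫ f) = (sSup ((fun φ => _) '' S) : sSupHom _ _) h
          rw [sSupHom_sSup_apply, sSupHom_sSup_apply, iSup_image]
          rfl })
    (fun Y φ => sSupHom.ext fun h => congrArg φ (Category.comp_id h))
    (fun g f φ => sSupHom.ext fun h => congrArg φ (Category.assoc h g f).symm)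
    (fun {Z Y} S φ => sSupHom.ext fun h => by
      change φ (h ≫ sSup S) = _
      rw [comp_sSup, map_sSup, Set.image_image, sSup_image]
      change _ = (sSup (Set.range _) : sSupHom (X ⟶ Z) (Set PUnit.{u + 1})) h
      rw [sSupHom_sSup_apply, iSup_range]
      refine iSup_congr fun f => ?_
      change _ = (sSup (Set.range _) : sSupHom (X ⟶ Z) (Set PUnit.{u + 1})) h
      rw [sSupHom_sSup_apply, iSup_range]
      rfl)

/-- The character of `B` that detects the elements not below `b`. -/
def character {B : QModule Q} {X : Q} (b : B.elements X) : B ⟶ characters X :=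
  homMk
    (fun Y =>
      -- The negation makes this preserve suprema: a supremum fails to lie below `b` exactly when
      -- some member does.
      { toFun := fun y =>
          { toFun := fun h => {_x | ¬ B.act h y ≤ b}
            map_sSup' := fun S => by
              ext
              simp [act_sSup] }
        map_sSup' := fun S => sSupHom.ext fun h => by
          ext x
          change ¬ B.act h (sSup S) ≤ b ↔
            x ∈ ⨆ φ ∈ _ '' S, (φ : sSupHom (X ⟶ Y) (Set PUnit.{u + 1})) h
          rw [iSup_image, map_sSup]
          change _ ↔ x ∈ ⨆ y ∈ S, {_x | ¬ B.act h y ≤ b}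
          simp })
    (fun {Z Y} f y => sSupHom.ext fun h => by
      ext
      change ¬ B.act h (B.act f y) ≤ b ↔ ¬ B.act (h ≫ f) y ≤ b
      rw [act_comp])

lemma character_eq_iff {B : QModule Q} {X : Q} {b b' : B.elements X} {Y : Q}
    {y : B.elements Y} :
    app (character b) Y y = app (character b') Y y ↔
      ∀ h : X ⟶ Y, B.act h y ≤ b ↔ B.act h y ≤ b' := by
  constructor
  · intro e h
    have := DFunLike.congr_fun (F := sSupHom (X ⟶ Y) (Set PUnit.{u + 1})) e h
    exact not_iff_not.1 (Set.ext_iff.1 this PUnit.unit)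
  · intro e
    refine sSupHom.ext fun h => ?_
    ext
    exact not_congr (e h)

/-- For `b` in `B`, let `c` be the largest element with `α c ≤ b`; it exists because `α` preserves
suprema. An element of `C` at `X` has image below `b` iff it has image below `α c`, so the
characters of `b` and of `α c` agree after `α`, hence are equal. Evaluating them at `b` itself and
`𝟙 X` gives `b ≤ α c`. -/
theorem surjective_of_epi {C B : QModule Q} (α : C ⟶ B) [Epi α] (X : Q) :
    Function.Surjective (app α X) := by
  intro b
  set c : C.elements X := sSup {c | app α X c ≤ b} with hc
  have hcb : app α X c ≤ b := by
    rw [hc, map_sSup]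
    exact sSup_le (by rintro _ ⟨c, hc, rfl⟩; exact hc)
  have e : α ≫ character b = α ≫ character (app α X c) := by
    refine hom_ext fun Y m => ?_
    rw [app_comp, app_comp, character_eq_iff]
    intro h
    rw [← app_act]
    exact ⟨fun hb => OrderHomClass.mono (app α X) (le_sSup hb), fun hb => hb.trans hcb⟩
  rw [cancel_epi] at e
  have := (character_eq_iff (y := b)).1 (congrArg (fun β => app β X b) e) (𝟙 X)
  rw [act_id] at this
  exact ⟨c, hcb.antisymm (this.1 le_rfl)⟩

theorem epi_of_surjective {C B : QModule Q} (α : C ⟶ B)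
    (h : ∀ X, Function.Surjective (app α X)) : Epi α where
  left_cancellation β γ e := hom_ext fun X b => by
    obtain ⟨c, rfl⟩ := h X b
    exact congrArg (fun δ => app δ X c) e

/-! ### Representable modules are projective -/

/-- The morphism out of `Q(-, X)` that corresponds to an element at `X`. -/
def ofElement {M : QModule Q} {X : Q} (m : M.elements X) : representableModule X ⟶ M :=
  homMk
    (fun Y =>
      { toFun := fun f : Y ⟶ X => M.act f m
        map_sSup' := fun S => (M.act_sSup S m).trans sSup_image.symm })
    (fun g f => M.act_comp g f m)

/-- The Yoneda argument: naturality at `f`, applied to the identity of `X`. -/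
lemma app_eq_act {M : QModule Q} {X : Q} (α : representableModule X ⟶ M) {Y : Q} (f : Y ⟶ X) :
    app α Y f = M.act f (app α X (𝟙 X)) := by
  refine Eq.trans ?_ (app_act α f (𝟙 X : X ⟶ X))
  exact congrArg (app α Y) (Category.comp_id f).symm

/-- A lift is a choice of preimage `c` of the element that `β` assigns to `𝟙 X`; both morphisms then
agree since they agree at the identity. -/
theorem projective_representableModule (X : Q) : Projective (representableModule X) where
  factors {B C} β α _ := by
    obtain ⟨c, hc⟩ := surjective_of_epi α X (app β X (𝟙 X))
    refine ⟨ofElement c, hom_ext fun Y f => ?_⟩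
    refine (app_act α f c).trans ?_
    rw [hc]
    exact (app_eq_act β f).symm

/-! ### Direct sums of modules -/

section

variable {I : Type u} (M : I → QModule Q)

/-- The direct sum of a family of modules: the componentwise product. -/
def sum : QModule Q :=
  mk (fun X => ∀ i, (M i).elements X)
    (fun {Y X} f =>
      { toFun := fun m i => (M i).act f (m i)
        map_sSup' := fun S => by
          funext i
          rw [sSup_apply_eq_sSup_image, sSup_apply_eq_sSup_image, map_sSup, Set.image_image,
            Set.image_image] })
    (fun X m => funext fun i => (M i).act_id X (m i))
    (fun g f m => funext fun i => (M i).act_comp g f (m i))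
    (fun S m => funext fun i => by
      simp only [iSup_apply]
      exact (M i).act_sSup S (m i))

open Classical in
/-- The inclusion of a factor into a product of complete lattices. -/
noncomputable def single {I : Type u} (E : I → Type u) [∀ i, CompleteLattice (E i)] (i : I) :
    sSupHom (E i) (∀ j, E j) where
  toFun m := Function.update ⊥ i m
  map_sSup' S := by
    funext j
    rw [sSup_apply_eq_sSup_image, Set.image_image]
    obtain rfl | h := eq_or_ne j i
    · simp
    · simp [h, sSup_image]

lemma single_self {I : Type u} (E : I → Type u) [∀ i, CompleteLattice (E i)] (i : I) (m : E i) :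
    single E i m i = m := by
  simp [single]

lemma single_of_ne {I : Type u} (E : I → Type u) [∀ i, CompleteLattice (E i)] {i j : I}
    (h : i ≠ j) (m : E i) : single E i m j = ⊥ := by
  simp [single, h.symm]

lemma iSup_single {I : Type u} (E : I → Type u) [∀ i, CompleteLattice (E i)] (m : ∀ i, E i) :
    ⨆ i, single E i (m i) = m := by
  funext j
  rw [iSup_apply]
  refine le_antisymm (iSup_le fun i => ?_) (le_iSup_of_le j (single_self E j (m j)).ge)
  obtain rfl | h := eq_or_ne i j
  · exact (single_self E i (m i)).le
  · exact (single_of_ne E h (m i)).le.trans bot_le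

/-- The componentwise product is a direct sum in the quantaloid of modules. -/
noncomputable def directSumSum : DirectSum M (sum M) where
  ι i := homMk (fun X => single (fun j => (M j).elements X) i)
    (fun {Y X} f m => by
      funext j
      change single (fun j => (M j).elements Y) i ((M i).act f m) j =
        (M j).act f (single (fun j => (M j).elements X) i m j)
      obtain rfl | h := eq_or_ne i j
      · rw [single_self, single_self]
      · rw [single_of_ne _ h, single_of_ne _ h, map_bot])
  π i := homMk
    (fun X =>
      { toFun := fun m : ∀ j, (M j).elements X => m i
        map_sSup' := fun S => sSup_apply_eq_sSup_image })
    (fun f m => rfl)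
  ι_π_self i := hom_ext fun X m => single_self (fun j => (M j).elements X) i m
  ι_π_ne i j h := hom_ext fun X m =>
    (single_of_ne (fun j => (M j).elements X) h m).trans (app_bot X m).symm
  iSup_π_ι := hom_ext fun X m => by
    rw [app_iSup]
    exact iSup_single (fun j => (M j).elements X) m

end

end QModule

/-! ### Direct sums in an arbitrary quantaloid -/

namespace DirectSum

variable {C : Type u} [Category.{v} C] [Quantaloid C] {I : Type w} {F : I → C} {S : C}

/-- The coproduct property of a direct sum: by orthogonality, only the term `j = i` of the supremum
survives. -/
theorem ι_desc (d : DirectSum F S) {T : C} (g : ∀ i, F i ⟶ T) (i : I) :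
    d.ι i ≫ ⨆ j, d.π j ≫ g j = g i := by
  rw [iSup, comp_sSup, sSup_image, iSup_range]
  refine le_antisymm (iSup_le fun j => ?_) (le_iSup_of_le i ?_)
  · obtain rfl | h := eq_or_ne i j
    · rw [← Category.assoc, d.ι_π_self, Category.id_comp]
    -- As `⊥` is the empty supremum, composing it with `g j` gives `⊥` again.
    · rw [← Category.assoc, d.ι_π_ne i j h, ← sSup_empty, sSup_comp]
      simp
  · rw [← Category.assoc, d.ι_π_self, Category.id_comp]

theorem projective (d : DirectSum F S) (h : ∀ i, Projective (F i)) : Projective S where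
  factors {B A} f e _ := by
    -- Lift each restriction of `f` to a summand and glue the lifts. Since the `π i ≫ ι i` have
    -- supremum `𝟙 S`, `f` is likewise glued from its restrictions.
    refine ⟨⨆ i, d.π i ≫ Projective.factorThru (d.ι i ≫ f) e, ?_⟩
    rw [iSup, sSup_comp, ← Set.range_comp]
    conv_rhs => rw [← Category.id_comp f, ← d.iSup_π_ι, iSup, sSup_comp, ← Set.range_comp]
    simp [Function.comp_def]

end DirectSum

end Quantaloid

theorem propositiona3 (Q : Type u) [SmallCategory Q] [Quantaloid Q]
    (F : Quantaloid.QModule Q) :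
    Projective F ↔
      ∃ (I : Type u) (M : I → Quantaloid.QModule Q) (S : Quantaloid.QModule Q),
        (∀ i, Quantaloid.IsRepresentable (M i)) ∧
          Nonempty (Quantaloid.DirectSum M S) ∧ Nonempty (Retract F S) := by
  constructor
  · intro hF
    -- One summand per element of `F`; smallness of `Q` keeps this index type in `Type u`.
    let I : Type u := Σ X : Q, F.elements X
    let M : I → Quantaloid.QModule Q := fun i => Quantaloid.representableModule i.1
    let d := Quantaloid.QModule.directSumSum M
    let p : Quantaloid.QModule.sum M ⟶ F :=
      ⨆ i, d.π i ≫ Quantaloid.QModule.ofElement i.2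
    have hp : Epi p := Quantaloid.QModule.epi_of_surjective p fun X x => by
      -- The identity of `X`, placed in the summand indexed by `x`, is sent by `p` to the action of
      -- `𝟙 X` on `x`.
      refine ⟨Quantaloid.QModule.app (d.ι ⟨X, x⟩) X (𝟙 X : X ⟶ X), ?_⟩
      refine Eq.trans ?_ (F.act_id X x)
      exact congrArg (fun β : M ⟨X, x⟩ ⟶ F => Quantaloid.QModule.app β X (𝟙 X : X ⟶ X))
        (d.ι_desc (fun i => Quantaloid.QModule.ofElement i.2) ⟨X, x⟩)
    exact ⟨I, M, Quantaloid.QModule.sum M, fun i => ⟨i.1, ⟨Iso.refl _⟩⟩, ⟨d⟩,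
      ⟨⟨Projective.factorThru (𝟙 F) p, p, Projective.factorThru_comp _ _⟩⟩⟩
  · rintro ⟨I, M, S, hM, ⟨d⟩, ⟨r⟩⟩
    have hS : Projective S := d.projective fun i => by
      obtain ⟨X, ⟨e⟩⟩ := hM i
      exact Projective.of_iso e.symm (Quantaloid.QModule.projective_representableModule X)
    exact r.projective
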